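/- Conventions. Let $X,Y$ be compact Hausdorff spaces and let $\exp X$, $\exp Y$ be their hyperspaces of non-empty closed subsets with the Vietoris topology. Let $L$ be a compact Lawson lattice, i.e. a distributive compact Hausdorff topological lattice in which every point has a local base of upper subsemilattices and a local base of lower subsemilattices; $0,1$ are its bottom and top. Write $\beta\ll\alpha$ ($\beta$ is way below $\alpha$) if for every non-empty directed $D\subset L$ with $\alpha\le\sup D$ there is $\gamma\in D$ with $\beta\le\gamma$. Crisp notions. An ambiguous representation between $X$ and $Y$ is a set $R\subset\exp X\times\exp Y$ such that: $(A,B)\in R$, $A'\subset A$, $B\subset B'$ imply $(A',B')\in R$; $(A,Y)\in R$ for all $A$; and every set $AR=\{B\mid (A,B)\in R\}$ is closed in $\exp Y$. It is strict if every set $\{A\mid (A,B)\in R\}$ is closed in $\exp X$. A set $C\in\exp Y$ is $R$-unavoidable for $A$ if $C\cap B\ne\emptyset$ for all $B\in AR$. Put $$R^{\smile}=\{(\tilde B,\tilde A)\in\exp Y\times\exp X\mid \forall A\in\exp X\ (A\cap\tilde A=\emptyset\Rightarrow\exists B\in AR,\ B\cap\tilde B=\emptyset)\}.$$ $R$ is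 pseudo-invertible if $(R^{\smile})^{\smile}=R$, and it is open if it is strict and pseudo-invertible and $R^{\smile}$ is a strict ambiguous representation. $L$-fuzzy notions. For $R\subset\exp X\times\exp Y\times L$ put $R_\alpha=\{(A,B)\mid(A,B,\alpha)\in R\}$. $R$ is an $L$-ambiguous representation if: $(A,B,\alpha)\in R$, $A'\subset A$, $B\subset B'$, $\alpha'\le\alpha$ imply $(A',B',\alpha')\in R$; $(A,B,\alpha),(A,B,\beta)\in R$ imply $(A,B,\alpha\vee\beta)\in R$; $(A,Y,\alpha),(A,B,0)\in R$ for all $A,B,\alpha$; and for every $A$ the set $\{(B,\alpha)\mid(A,B,\alpha)\in R\}$ is closed in $\exp Y\times L$. It is strict if for every $B$ the set $\{(A,\alpha)\mid(A,B,\alpha)\in R\}$ is closed in $\exp X\times L$. Let $R^{\smile}\subset\exp Y\times\exp X\times L$ be given by $(R^{\smile})_0=\exp Y\times\exp X$ and $(R^{\smile})_\alpha=\bigcap_{\beta\ll\alpha}(R_\beta)^{\smile}$ for $\alpha\ne0$. $R$ is pseudo-invertible if $(R^{\smile})^{\smile}=R$, and it is open if both $R$ and $R^{\smile}$ are strict $L$-ambiguous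 representations and $(R^{\smile})^{\smile}=R$. Proposition. (I) For a pseudo-invertible strict $L$-ambiguous representation $R\subset\exp X\times\exp Y\times L$ the following are equivalent: (1) $R$ is open; (2) for every open $U\subset X$ and every $\alpha\in L$, $\alpha\ne0$, the set of all $C\in\exp Y$ that are $R_\beta$-unavoidable for some $A\in\exp X$ with $A\subset U$ and some $\beta\ll\alpha$ is open in $\exp Y$; (3) for all $A\in\exp X$, open $U\subset X$ with $A\subset U$, $B\in\exp Y$ and $\alpha,\beta\in L$ such that $\alpha\ne0$, $\beta\ll\alpha$ and $B$ is $R_\beta$-unavoidable for $A$, there are finitely many open sets $V_1,\dots,V_n\subset Y$, an element $\gamma\ll\alpha$ and a closed neighborhood $G$ of $A$ with $G\subset U$ such that $V_i\cap B\ne\emptyset$ for $i=1,\dots,n$ and every $B'\in GR_\gamma$ contains at least one $V_i$. (II) For a pseudo-invertible strict ambiguous representation $R\subset\exp X\times\exp Y$ the following are equivalent: (1) $R$ is open; (2) for every open $U\subset X$ the set of all $C\in\exp Y$ that are $R$-unavoidable for some $A\in\exp X$ with $A\subset U$ is open in $\exp Y$; (3) for all $A\in\exp X$, open $U\subset X$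 with $A\subset U$ and $B\in\exp Y$ that is $R$-unavoidable for $A$, there are finitely many open sets $V_1,\dots,V_n\subset Y$ and a closed neighborhood $G$ of $A$ with $G\subset U$ such that $V_i\cap B\ne\emptyset$ for $i=1,\dots,n$ and every $B'\in GR$ contains at least one $V_i$. -/

import Mathlib

open Set Topology

namespace Ambiguous

universe u v w

/-- The hyperspace `exp X` of a compactum `X`: nonempty closed (equivalently, as `X` is compact
Hausdorff, nonempty compact) subsets. It carries Mathlib's Vietoris topology
`TopologicalSpace.NonemptyCompacts.topology`. -/
abbrev Exp (X : Type u) [TopologicalSpace X] : Type u := TopologicalSpace.NonemptyCompacts X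

/-- `α` is way below `β`: whenever `β ≤ sup D` for a (nonempty) directed set `D`, some element of
`D` is above `α`. -/
def WayBelow {L : Type w} [PartialOrder L] (α β : L) : Prop :=
  ∀ (D : Set L) (s : L), D.Nonempty → DirectedOn (· ≤ ·) D → IsLUB D s → β ≤ s →
    ∃ γ ∈ D, α ≤ γ

/-- A compact Lawson lattice: a distributive compact Hausdorff topological lattice in which every
point has a local base of upper subsemilattices and a local base of lower subsemilattices. -/
class CompactLawsonLattice (L : Type w) [TopologicalSpace L] [DistribLattice L] : Prop
    extends CompactSpace L, T2Space L, TopologicalLattice L where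
  exists_supClosed : ∀ (x : L), ∀ U ∈ 𝓝 x, ∃ V ∈ 𝓝 x, V ⊆ U ∧ SupClosed V
  exists_infClosed : ∀ (x : L), ∀ U ∈ 𝓝 x, ∃ V ∈ 𝓝 x, V ⊆ U ∧ InfClosed V

section Crisp

variable {X : Type u} {Y : Type v} [TopologicalSpace X] [TopologicalSpace Y]

/-- Ambiguous representations between `X` and `Y`. -/
structure IsAmb (R : Set (Exp X × Exp Y)) : Prop where
  mono : ∀ (A A' : Exp X) (B B' : Exp Y), (A' : Set X) ⊆ A → (B : Set Y) ⊆ B' →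
    (A, B) ∈ R → (A', B') ∈ R
  whole : ∀ (A : Exp X) (B : Exp Y), (B : Set Y) = univ → (A, B) ∈ R
  closed_right : ∀ A : Exp X, IsClosed {B : Exp Y | (A, B) ∈ R}

/-- Strictness: all sets `R B` are closed. -/
def IsStrict (R : Set (Exp X × Exp Y)) : Prop :=
  ∀ B : Exp Y, IsClosed {A : Exp X | (A, B) ∈ R}

/-- `C` is `R`-unavoidable for `A`: it meets every `B` with `(A, B) ∈ R`, i.e. `C ∈ (A R)^⊥`. -/
def Unavoidable (R : Set (Exp X × Exp Y)) (A : Exp X) (C : Exp Y) : Prop :=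
  ∀ B : Exp Y, (A, B) ∈ R → ((C : Set Y) ∩ B).Nonempty

/-- The relation `R^⌣ ⊆ exp Y × exp X`. -/
def pinv (R : Set (Exp X × Exp Y)) : Set (Exp Y × Exp X) :=
  {p | ∀ A : Exp X, (A : Set X) ∩ p.2 = ∅ → ∃ B : Exp Y, (A, B) ∈ R ∧ (B : Set Y) ∩ p.1 = ∅}

/-- `R` is pseudo-invertible. -/
def IsPseudoInvertible (R : Set (Exp X × Exp Y)) : Prop := pinv (pinv R) = R

/-- Open ambiguous representations. -/
structure IsOpenAmb (R : Set (Exp X × Exp Y)) : Prop where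
  amb : IsAmb R
  strict : IsStrict R
  pseudoInvertible : IsPseudoInvertible R
  pinv_amb : IsAmb (pinv R)
  pinv_strict : IsStrict (pinv R)

/-- For each open `U`, the unavoidable sets of all `A ⊆ U` form an open set. -/
def UnavoidableOpen (R : Set (Exp X × Exp Y)) : Prop :=
  ∀ U : Set X, IsOpen U →
    IsOpen {C : Exp Y | ∃ A : Exp X, (A : Set X) ⊆ U ∧ Unavoidable R A C}

/-- The local finite condition, with a closed neighbourhood `G` of `A` inside `U`. -/
def LocalFinite (R : Set (Exp X × Exp Y)) : Prop :=
  ∀ (A : Exp X) (U : Set X) (B : Exp Y), IsOpen U → (A : Set X) ⊆ U → Unavoidable R A B →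
    ∃ (n : ℕ) (V : Fin n → Set Y) (G : Exp X),
      (∀ i, IsOpen (V i)) ∧ (A : Set X) ⊆ interior (G : Set X) ∧ (G : Set X) ⊆ U ∧
      (∀ i, (V i ∩ (B : Set Y)).Nonempty) ∧
      ∀ B' : Exp Y, (G, B') ∈ R → ∃ i, V i ⊆ (B' : Set Y)

end Crisp

section Fuzzy

variable {X : Type u} {Y : Type v} {L : Type w} [TopologicalSpace X] [TopologicalSpace Y]
  [TopologicalSpace L] [DistribLattice L] [BoundedOrder L]

/-- The `α`-cut of a subset of `exp X × exp Y × L`. -/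
def cut (R : Set (Exp X × Exp Y × L)) (α : L) : Set (Exp X × Exp Y) :=
  {p | (p.1, p.2, α) ∈ R}

/-- `L`-ambiguous representations between `X` and `Y`. -/
structure IsLAmb (R : Set (Exp X × Exp Y × L)) : Prop where
  mono : ∀ (A A' : Exp X) (B B' : Exp Y) (α α' : L), (A' : Set X) ⊆ A → (B : Set Y) ⊆ B' →
    α' ≤ α → (A, B, α) ∈ R → (A', B', α') ∈ R
  sup : ∀ (A : Exp X) (B : Exp Y) (α β : L), (A, B, α) ∈ R → (A, B, β) ∈ R →
    (A, B, α ⊔ β) ∈ R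
  whole : ∀ (A : Exp X) (B : Exp Y) (α : L), (B : Set Y) = univ → (A, B, α) ∈ R
  bot : ∀ (A : Exp X) (B : Exp Y), (A, B, ⊥) ∈ R
  closed_right : ∀ A : Exp X, IsClosed {p : Exp Y × L | (A, p.1, p.2) ∈ R}

/-- Strictness: all sets `R B ⊆ exp X × L` are closed. -/
def IsLStrict (R : Set (Exp X × Exp Y × L)) : Prop :=
  ∀ B : Exp Y, IsClosed {p : Exp X × L | (p.1, B, p.2) ∈ R}

/-- The relation `R^⌣ ⊆ exp Y × exp X × L`. Its cut at `α ≠ 0` is the intersection of the crisp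
relations `(R_β)^⌣` over all `β` way below `α`; its cut at `0` is everything, as for every subgraph
of an `L`-valued function. -/
def lpinv (R : Set (Exp X × Exp Y × L)) : Set (Exp Y × Exp X × L) :=
  {p | p.2.2 = ⊥ ∨ ∀ β : L, WayBelow β p.2.2 → (p.1, p.2.1) ∈ pinv (cut R β)}

/-- `R` is pseudo-invertible. -/
def IsLPseudoInvertible (R : Set (Exp X × Exp Y × L)) : Prop := lpinv (lpinv R) = R

/-- Open `L`-ambiguous representations. -/
structure IsOpenLAmb (R : Set (Exp X × Exp Y × L)) : Prop where
  amb : IsLAmb R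
  strict : IsLStrict R
  pinv_amb : IsLAmb (lpinv R)
  pinv_strict : IsLStrict (lpinv R)
  pseudoInvertible : IsLPseudoInvertible R

/-- For each open `U` and each `α ≠ 0`, the sets that are `R_β`-unavoidable for some `A ⊆ U` and
some `β` way below `α` form an open set. -/
def LUnavoidableOpen (R : Set (Exp X × Exp Y × L)) : Prop :=
  ∀ (U : Set X) (α : L), IsOpen U → α ≠ ⊥ →
    IsOpen {C : Exp Y | ∃ (A : Exp X) (β : L), (A : Set X) ⊆ U ∧ WayBelow β α ∧
      Unavoidable (cut R β) A C}

/-- The local finite condition, with a closed neighbourhood `G` of `A` inside `U`. -/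
def LLocalFinite (R : Set (Exp X × Exp Y × L)) : Prop :=
  ∀ (A : Exp X) (U : Set X) (B : Exp Y) (α β : L), IsOpen U → (A : Set X) ⊆ U → α ≠ ⊥ →
    Unavoidable (cut R β) A B → WayBelow β α →
    ∃ (n : ℕ) (V : Fin n → Set Y) (γ : L) (G : Exp X),
      (∀ i, IsOpen (V i)) ∧ (A : Set X) ⊆ interior (G : Set X) ∧ (G : Set X) ⊆ U ∧
      WayBelow γ α ∧ (∀ i, (V i ∩ (B : Set Y)).Nonempty) ∧
      ∀ B' : Exp Y, (G, B') ∈ cut R γ → ∃ i, V i ⊆ (B' : Set Y)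

end Fuzzy

end Ambiguous

/-! A pair `(C, F)` fails to lie in `pinv R` exactly when `C` is unavoidable for some `A` inside the
complement of `F`. So (2) for `U = Fᶜ` says that the slice of `pinv R` at `F` is closed, and (2) is
strictness of `pinv R`. Only `U = X` is not such a complement; there pseudo-invertibility forces
every set related to `X` to be all of `Y`, so every `C` is unavoidable. The other axioms for `pinv
R` come for free, hence (1) ⇔ (2). For (2) ⇔ (3), a Vietoris neighbourhood is tested on finite sets:
choosing one point from each `V i` outside `B'` would give a member missing `B'`. The fuzzy case
repeats this with levels. It needs way-below to be an open condition in its upper argument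
(`WayBelow.eventually`) and to interpolate (`WayBelow.exists_between`); both follow from small
inf-closed neighbourhoods in `L`. -/

namespace Ambiguous

open TopologicalSpace Filter

/-! ### Vietoris neighbourhoods and separation in the hyperspace. -/

section Hyperspace

variable {X : Type*} {Y : Type*} [TopologicalSpace X] [TopologicalSpace Y]

/-- A Vietoris neighbourhood of `B` yields finitely many open sets meeting `B`, one of which is
contained in each set that meets all members of the neighbourhood. -/
theorem exists_open_family_of_isOpen {O : Set (Exp Y)} (hO : IsOpen O) {B : Exp Y} (hB : B ∈ O) :
    ∃ (n : ℕ) (V : Fin n → Set Y), (∀ i, IsOpen (V i)) ∧ (∀ i, (V i ∩ (B : Set Y)).Nonempty) ∧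
      ∀ S : Set Y, (∀ C ∈ O, ((C : Set Y) ∩ S).Nonempty) → ∃ i, V i ⊆ S := by
  obtain ⟨_, ⟨u, ⟨hfin, hne, hopen⟩, rfl⟩, hBu, huO⟩ :=
    NonemptyCompacts.isTopologicalBasis.exists_subset_of_mem_open hB hO
  obtain ⟨n, V, -, rfl⟩ := hfin.fin_param
  refine ⟨n, V, fun i => hopen _ (mem_range_self i), fun i => ?_, fun S hS => ?_⟩
  · rw [inter_comm]
    exact hBu.2 _ (mem_range_self i)
  · by_contra! h
    -- The finite set of these points lies in the basic neighbourhood but misses `S`.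
    choose y hyV hyS using fun i => not_subset.1 (h i)
    obtain ⟨_, i, -⟩ := hne
    let C : Exp Y := ⟨⟨range y, (finite_range y).isCompact⟩, ⟨y i, mem_range_self i⟩⟩
    have hC : C ∈ O := by
      refine huO ⟨?_, ?_⟩
      · rintro _ ⟨j, rfl⟩
        exact ⟨V j, mem_range_self j, hyV j⟩
      · rintro _ ⟨j, rfl⟩
        exact ⟨y j, mem_range_self j, hyV j⟩
    obtain ⟨_, ⟨j, rfl⟩, hj⟩ := hS C hC
    exact hyS j hj

theorem isOpen_forall_inter_nonempty {n : ℕ} {V : Fin n → Set Y} (hV : ∀ i, IsOpen (V i)) :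
    IsOpen {C : Exp Y | ∀ i, (V i ∩ (C : Set Y)).Nonempty} := by
  simp only [ofPred_forall]
  refine isOpen_iInter_of_finite fun i => ?_
  simpa only [inter_comm] using NonemptyCompacts.isOpen_inter_nonempty_of_isOpen (hV i)

/-- The closure of an open neighbourhood of `A`, shrunk inside `U`. -/
theorem exists_closed_nhd_subset [CompactSpace X] [T2Space X] (A : Exp X) {U : Set X}
    (hU : IsOpen U) (hAU : (A : Set X) ⊆ U) :
    ∃ (W : Set X) (G : Exp X), IsOpen W ∧ (A : Set X) ⊆ W ∧ W ⊆ (G : Set X) ∧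
      (A : Set X) ⊆ interior (G : Set X) ∧ (G : Set X) ⊆ U := by
  obtain ⟨W, hW, hAW, hWU⟩ := normal_exists_closure_subset A.isCompact.isClosed hU hAU
  exact ⟨W, ⟨⟨closure W, isClosed_closure.isCompact⟩, (A.nonempty.mono hAW).closure⟩, hW, hAW,
    subset_closure, hAW.trans (interior_maximal subset_closure hW), hWU⟩

/-- The complement of an open proper subset, as a point of the hyperspace. -/
theorem exists_coe_eq_compl [CompactSpace X] {U : Set X} (hU : IsOpen U) (hne : U ≠ univ) :
    ∃ F : Exp X, (F : Set X) = Uᶜ :=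
  ⟨⟨⟨Uᶜ, hU.isClosed_compl.isCompact⟩, nonempty_compl.2 hne⟩, rfl⟩

end Hyperspace

/-! ### Crisp representations. -/

section Crisp

variable {X : Type*} {Y : Type*} [TopologicalSpace X] [TopologicalSpace Y]

theorem Unavoidable.mono {R R' : Set (Exp X × Exp Y)} {A A' : Exp X} {C : Exp Y}
    (h : Unavoidable R A C) (hsub : ∀ B, (A', B) ∈ R' → (A, B) ∈ R) : Unavoidable R' A' C :=
  fun B hB => h B (hsub B hB)

theorem mem_pinv_iff {R : Set (Exp X × Exp Y)} {C : Exp Y} {F : Exp X} :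
    (C, F) ∈ pinv R ↔ ∀ A : Exp X, (A : Set X) ⊆ (F : Set X)ᶜ → ¬Unavoidable R A C := by
  simp only [pinv, Unavoidable, mem_ofPred_eq, ← disjoint_iff_inter_eq_empty,
    ← subset_compl_iff_disjoint_right, not_forall, not_nonempty_iff_eq_empty, exists_prop]
  simp only [subset_compl_iff_disjoint_right, disjoint_iff_inter_eq_empty, inter_comm]

theorem notMem_pinv_iff {R : Set (Exp X × Exp Y)} {C : Exp Y} {F : Exp X} :
    (C, F) ∉ pinv R ↔ ∃ A : Exp X, (A : Set X) ⊆ (F : Set X)ᶜ ∧ Unavoidable R A C := by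
  simp [mem_pinv_iff]

theorem pinv_mono {R : Set (Exp X × Exp Y)} {C C' : Exp Y} {F F' : Exp X}
    (hC : (C' : Set Y) ⊆ C) (hF : (F : Set X) ⊆ F') (h : (C, F) ∈ pinv R) : (C', F') ∈ pinv R := by
  rw [mem_pinv_iff] at h ⊢
  intro A hA hCA
  exact h A (hA.trans (compl_subset_compl.2 hF)) fun B hB =>
    (hCA B hB).mono (inter_subset_inter_left _ hC)

theorem mem_pinv_of_eq_univ {R : Set (Exp X × Exp Y)} {C : Exp Y} {F : Exp X}
    (hF : (F : Set X) = univ) : (C, F) ∈ pinv R := by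
  rw [mem_pinv_iff]
  intro A hA
  rw [hF, compl_univ] at hA
  exact absurd (A.nonempty.mono hA) not_nonempty_empty

/-- Testing at a point outside `B` would require a nonempty set disjoint from the whole space. This
settles the case `U = univ` of condition (2). -/
theorem eq_univ_of_mem_pinv {Q : Set (Exp Y × Exp X)} {A : Exp X} {B : Exp Y}
    (hA : (A : Set X) = univ) (h : (A, B) ∈ pinv Q) : (B : Set Y) = univ := by
  by_contra hB
  obtain ⟨y, hy⟩ := nonempty_compl.2 hB
  obtain ⟨F, -, hF⟩ := h {y} (by simpa using hy)
  rw [hA, inter_univ] at hF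
  exact F.nonempty.ne_empty hF

/-- A union of Vietoris-open sets indexed by `A`, so `P` may be arbitrary; this is why `pinv R` has
closed right slices for every `R`. -/
theorem isOpen_exists_subset_compl [T2Space X] (P : Exp X → Prop) :
    IsOpen {F : Exp X | ∃ A : Exp X, (A : Set X) ⊆ (F : Set X)ᶜ ∧ P A} := by
  have h : {F : Exp X | ∃ A : Exp X, (A : Set X) ⊆ (F : Set X)ᶜ ∧ P A} =
      ⋃ A ∈ {A : Exp X | P A}, {F : Exp X | (F : Set X) ⊆ (A : Set X)ᶜ} := by
    ext F
    simp [subset_compl_comm, and_comm]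
  rw [h]
  exact isOpen_biUnion fun A _ =>
    NonemptyCompacts.isOpen_subsets_of_isOpen A.isCompact.isClosed.isOpen_compl

theorem isAmb_pinv [T2Space X] (R : Set (Exp X × Exp Y)) : IsAmb (pinv R) where
  mono _ _ _ _ hC hF h := pinv_mono hC hF h
  whole _ _ hF := mem_pinv_of_eq_univ hF
  closed_right C := by
    rw [← isOpen_compl_iff]
    simpa only [compl_ofPred, notMem_pinv_iff] using
      isOpen_exists_subset_compl fun A => Unavoidable R A C

variable {R : Set (Exp X × Exp Y)}

theorem unavoidableOpen_of_isStrict_pinv [CompactSpace X] (hpi : IsPseudoInvertible R)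
    (hs : IsStrict (pinv R)) : UnavoidableOpen R := by
  intro U hU
  by_cases hne : U = univ
  · subst hne
    rcases isEmpty_or_nonempty X with hX | hX
    · convert isOpen_empty
      ext C
      simp only [mem_ofPred_eq, mem_empty_iff_false, iff_false]
      rintro ⟨A, -⟩
      exact hX.false A.nonempty.some
    · convert isOpen_univ
      ext C
      simp only [mem_ofPred_eq, mem_univ, iff_true]
      refine ⟨⊤, subset_univ _, fun B hB => ?_⟩
      rw [← hpi] at hB
      rw [eq_univ_of_mem_pinv NonemptyCompacts.coe_top hB, inter_univ]
      exact C.nonempty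
  · obtain ⟨F, hF⟩ := exists_coe_eq_compl hU hne
    have h := (hs F).isOpen_compl
    simpa only [compl_ofPred, notMem_pinv_iff, hF, compl_compl] using h

theorem isStrict_pinv_of_unavoidableOpen [T2Space X] (h : UnavoidableOpen R) : IsStrict (pinv R) := by
  intro F
  rw [← isOpen_compl_iff]
  simpa only [compl_ofPred, notMem_pinv_iff] using h _ F.isCompact.isClosed.isOpen_compl

theorem localFinite_of_unavoidableOpen [CompactSpace X] [T2Space X] (hR : IsAmb R) (h : UnavoidableOpen R) :
    LocalFinite R := by
  intro A U B hU hAU hB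
  obtain ⟨W, G, hW, hAW, hWG, hAG, hGU⟩ := exists_closed_nhd_subset A hU hAU
  obtain ⟨n, V, hV, hVB, hVS⟩ := exists_open_family_of_isOpen (h W hW) ⟨A, hAW, hB⟩
  refine ⟨n, V, G, hV, hAG, hGU, hVB, fun B' hB' => hVS B' ?_⟩
  rintro C ⟨A', hA', hC⟩
  exact hC B' (hR.mono _ _ _ _ (hA'.trans hWG) Subset.rfl hB')

theorem unavoidableOpen_of_localFinite (h : LocalFinite R) : UnavoidableOpen R := by
  intro U hU
  rw [isOpen_iff_mem_nhds]
  rintro B ⟨A, hAU, hB⟩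
  obtain ⟨n, V, G, hV, -, hGU, hVB, hVG⟩ := h A U B hU hAU hB
  filter_upwards [(isOpen_forall_inter_nonempty hV).mem_nhds hVB] with C hC
  -- The neighbourhood `G` itself, not `A`, is the witness for all nearby `C`.
  refine ⟨G, hGU, fun B' hB' => ?_⟩
  obtain ⟨i, hi⟩ := hVG B' hB'
  exact (hC i).mono fun y hy => ⟨hy.2, hi hy.1⟩

end Crisp

/-! ### The way-below relation in a compact Lawson lattice. -/

section WayBelow

theorem WayBelow.trans_le {L : Type*} [PartialOrder L] {α β γ : L} (h : WayBelow α β)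
    (hle : β ≤ γ) : WayBelow α γ :=
  fun D s hne hD hs hγ => h D s hne hD hs (hle.trans hγ)

theorem WayBelow.le {L : Type*} [PartialOrder L] {α β : L} (h : WayBelow α β) : α ≤ β := by
  obtain ⟨γ, rfl, hγ⟩ := h {β} β (singleton_nonempty β) (directedOn_singleton β)
    isLUB_singleton le_rfl
  exact hγ

theorem wayBelow_bot {L : Type*} [PartialOrder L] [OrderBot L] (α : L) : WayBelow ⊥ α :=
  fun _ _ hne _ _ _ => hne.imp fun _ hd => ⟨hd, bot_le⟩

theorem WayBelow.sup {L : Type*} [DistribLattice L] {α β γ : L} (hα : WayBelow α γ)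
    (hβ : WayBelow β γ) : WayBelow (α ⊔ β) γ := by
  intro D s hne hD hs hγ
  obtain ⟨d, hd, hαd⟩ := hα D s hne hD hs hγ
  obtain ⟨e, he, hβe⟩ := hβ D s hne hD hs hγ
  obtain ⟨f, hf, hdf, hef⟩ := hD d hd e he
  exact ⟨f, hf, sup_le (hαd.trans hdf) (hβe.trans hef)⟩

variable {L : Type*} [TopologicalSpace L]

theorem isClosed_Iic_of_continuousInf [SemilatticeInf L] [T2Space L] [ContinuousInf L] (a : L) :
    IsClosed (Iic a) := by
  simpa only [Iic, ← inf_eq_left] using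
    isClosed_eq ((continuous_id' (X := L)).inf (continuous_const (y := a))) continuous_id'

theorem isClosed_Ici_of_continuousInf [SemilatticeInf L] [T2Space L] [ContinuousInf L] (a : L) :
    IsClosed (Ici a) := by
  simpa only [Ici, ← inf_eq_left] using
    isClosed_eq ((continuous_const (y := a)).inf (continuous_id' (X := L))) continuous_const

/-- In a compact topological semilattice a directed set accumulates at its supremum. -/
theorem mem_closure_of_directedOn_of_isLUB [SemilatticeInf L] [CompactSpace L] [T2Space L]
    [ContinuousInf L] {D : Set L} (hD : DirectedOn (· ≤ ·) D) (hne : D.Nonempty) {s : L}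
    (hs : IsLUB D s) : s ∈ closure D := by
  have : Nonempty D := hne.to_subtype
  -- A common point of the closed tails is an upper bound of `D` in its closure, hence equals `s`.
  obtain ⟨t, ht⟩ := IsCompact.nonempty_iInter_of_directed_nonempty_isCompact_isClosed
    (fun d : D => closure (D ∩ Ici (d : L)))
    (fun d e => by
      obtain ⟨f, hf, hdf, hef⟩ := hD d d.2 e e.2
      exact ⟨⟨f, hf⟩, closure_mono (inter_subset_inter_right _ (Ici_subset_Ici.2 hdf)),
        closure_mono (inter_subset_inter_right _ (Ici_subset_Ici.2 hef))⟩)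
    (fun d => Set.Nonempty.closure ⟨d, d.2, self_mem_Ici⟩)
    (fun _ => isClosed_closure.isCompact) (fun _ => isClosed_closure)
  rw [mem_iInter] at ht
  obtain ⟨d, hd⟩ := hne
  have htD : t ∈ closure D := closure_mono inter_subset_left (ht ⟨d, hd⟩)
  have hub : t ∈ upperBounds D := fun e he =>
    closure_minimal inter_subset_right (isClosed_Ici_of_continuousInf e) (ht ⟨e, he⟩)
  have hts : t ≤ s := closure_minimal (fun e he => hs.1 he) (isClosed_Iic_of_continuousInf s) htD
  rwa [le_antisymm hts (hs.2 hub)] at htD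

theorem infClosed_closure [SemilatticeInf L] [ContinuousInf L] {S : Set L}
    (hS : InfClosed S) : InfClosed (closure S) := by
  intro a ha b hb
  exact map_mem_closure₂ continuous_inf ha hb fun x hx y hy => hS hx hy

/-- A nonempty compact subsemilattice has a least element. -/
theorem exists_isLeast_of_infClosed [SemilatticeInf L] [T2Space L]
    [ContinuousInf L] {K : Set L} (hK : InfClosed K) (hc : IsCompact K) (hne : K.Nonempty) :
    ∃ m, IsLeast K m := by
  classical
  obtain ⟨m, hmK, hm⟩ := hc.inter_iInter_nonempty (fun x : K => Iic (x : L))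
    (fun x => isClosed_Iic_of_continuousInf _) fun u => by
      induction u using Finset.induction_on with
      | empty => simpa using hne
      | insert a u _ ih =>
        obtain ⟨x, hxK, hx⟩ := ih
        refine ⟨a ⊓ x, hK a.2 hxK, ?_⟩
        simp only [mem_iInter, mem_Iic] at hx ⊢
        intro b hb
        rcases Finset.mem_insert.1 hb with rfl | hb
        · exact inf_le_left
        · exact inf_le_right.trans (hx b hb)
  rw [mem_iInter] at hm
  exact ⟨m, hmK, fun x hx => hm ⟨x, hx⟩⟩

variable [DistribLattice L] [CompactLawsonLattice L]

/-- A lower bound of a neighbourhood of `α` is way below `α`. -/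
theorem wayBelow_of_mem_lowerBounds {α m : L} {V : Set L} (hV : V ∈ 𝓝 α)
    (hm : m ∈ lowerBounds V) : WayBelow m α := by
  intro D s hne hD hs hαs
  have hcont : Tendsto (fun x => α ⊓ x) (𝓝 s) (𝓝 α) := by
    have := ((continuous_const (y := α)).inf (continuous_id (X := L))).tendsto s
    simpa [inf_eq_left.2 hαs] using this
  obtain ⟨d, hdV, hd⟩ := mem_closure_iff_nhds.1 (mem_closure_of_directedOn_of_isLUB hD hne hs) _
    (hcont hV)
  exact ⟨d, hd, (hm hdV).trans inf_le_right⟩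

/-- Every neighbourhood of `α` contains an element that is way below all points near `α`. -/
theorem exists_mem_eventually_wayBelow {α : L} {U : Set L} (hU : U ∈ 𝓝 α) :
    ∃ m ∈ U, ∀ᶠ α' in 𝓝 α, WayBelow m α' := by
  obtain ⟨F, hF, hFc, hFU⟩ := exists_mem_nhds_isClosed_subset hU
  obtain ⟨V, hV, hVF, hinf⟩ := CompactLawsonLattice.exists_infClosed α F hF
  obtain ⟨m, hmV, hm⟩ := exists_isLeast_of_infClosed (infClosed_closure hinf)
    isClosed_closure.isCompact ⟨α, subset_closure (mem_of_mem_nhds hV)⟩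
  refine ⟨m, hFU (closure_minimal hVF hFc hmV), ?_⟩
  filter_upwards [eventually_mem_nhds_iff.2 hV] with α' hα'
  exact wayBelow_of_mem_lowerBounds hα' fun x hx => hm (subset_closure hx)

/-- The elements way below all points near `α` are directed and accumulate at `α`, so their supremum
is `α` and one of them dominates `β`. -/
theorem WayBelow.eventually {α β : L} (h : WayBelow β α) : ∀ᶠ α' in 𝓝 α, WayBelow β α' := by
  let D : Set L := {m | ∀ᶠ α' in 𝓝 α, WayBelow m α'}
  have hne : D.Nonempty := by
    obtain ⟨m, -, hm⟩ := exists_mem_eventually_wayBelow (univ_mem (f := 𝓝 α))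
    exact ⟨m, hm⟩
  have hD : DirectedOn (· ≤ ·) D := fun a ha b hb =>
    ⟨a ⊔ b, by filter_upwards [ha, hb] with x hax hbx using hax.sup hbx, le_sup_left, le_sup_right⟩
  have hlub : IsLUB D α := by
    refine ⟨fun m hm => (mem_of_mem_nhds hm : WayBelow m α).le, fun u hu => ?_⟩
    refine closure_minimal (s := D) (fun m hm => hu hm) (isClosed_Iic_of_continuousInf u) ?_
    refine mem_closure_iff_nhds.2 fun U hU => ?_
    obtain ⟨m, hmU, hm⟩ := exists_mem_eventually_wayBelow hU
    exact ⟨m, hmU, hm⟩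
  obtain ⟨m, hm, hβm⟩ := h D α hne hD hlub le_rfl
  filter_upwards [hm] with x hx using
    fun E s hE hdir hs hxs => (hx E s hE hdir hs hxs).imp fun e he => ⟨he.1, hβm.trans he.2⟩

/-- Interpolation for the way-below relation, with a nonzero interpolant. -/
theorem WayBelow.exists_between [BoundedOrder L] {α β : L} (h : WayBelow β α) (hα : α ≠ ⊥) :
    ∃ γ, γ ≠ ⊥ ∧ WayBelow β γ ∧ WayBelow γ α := by
  obtain ⟨m, ⟨hβm, hm⟩, hmα⟩ := exists_mem_eventually_wayBelow
    (inter_mem h.eventually (isOpen_ne.mem_nhds hα))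
  exact ⟨m, hm, hβm, mem_of_mem_nhds hmα⟩

/-- Continuity of `⊔` lets both arguments be lowered slightly; this yields the join axiom for `lpinv
R`. -/
theorem WayBelow.exists_le_sup {α β γ : L} (h : WayBelow γ (α ⊔ β)) :
    ∃ α' β', WayBelow α' α ∧ WayBelow β' β ∧ γ ≤ α' ⊔ β' := by
  have hcont : ∀ᶠ p : L × L in 𝓝 α ×ˢ 𝓝 β, WayBelow γ (p.1 ⊔ p.2) := by
    rw [← nhds_prod_eq]
    exact (continuous_sup.tendsto (α, β)).eventually h.eventually
  obtain ⟨U, hU, W, hW, hUW⟩ := mem_prod_iff.1 hcont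
  obtain ⟨a, haU, ha⟩ := exists_mem_eventually_wayBelow hU
  obtain ⟨b, hbW, hb⟩ := exists_mem_eventually_wayBelow hW
  exact ⟨a, b, mem_of_mem_nhds ha, mem_of_mem_nhds hb, WayBelow.le (hUW (mk_mem_prod haU hbW))⟩

end WayBelow

/-! ### Lattice-valued representations. -/

section Fuzzy

variable {X : Type*} {Y : Type*} {L : Type*} [TopologicalSpace X] [TopologicalSpace Y]
  [DistribLattice L] [BoundedOrder L] {R : Set (Exp X × Exp Y × L)}

theorem notMem_lpinv_iff {C : Exp Y} {F : Exp X} {α : L} :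
    (C, F, α) ∉ lpinv R ↔ α ≠ ⊥ ∧ ∃ (A : Exp X) (β : L), (A : Set X) ⊆ (F : Set X)ᶜ ∧
      WayBelow β α ∧ Unavoidable (cut R β) A C := by
  simp only [lpinv, mem_ofPred_eq, not_or, not_forall, notMem_pinv_iff, exists_prop]
  refine and_congr_right fun _ => ⟨?_, ?_⟩
  · rintro ⟨β, hβ, A, hA, hC⟩
    exact ⟨A, β, hA, hβ, hC⟩
  · rintro ⟨A, β, hA, hβ, hC⟩
    exact ⟨β, hβ, A, hA, hC⟩

theorem lUnavoidableOpen_of_lLocalFinite (h : LLocalFinite R) : LUnavoidableOpen R := by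
  intro U α hU hα
  rw [isOpen_iff_mem_nhds]
  rintro B ⟨A, β, hAU, hβ, hB⟩
  obtain ⟨n, V, γ, G, hV, -, hGU, hγ, hVB, hVG⟩ := h A U B α β hU hAU hα hB hβ
  filter_upwards [(isOpen_forall_inter_nonempty hV).mem_nhds hVB] with C hC
  refine ⟨G, γ, hGU, hγ, fun B' hB' => ?_⟩
  obtain ⟨i, hi⟩ := hVG B' hB'
  exact (hC i).mono fun y hy => ⟨hy.2, hi hy.1⟩

variable [TopologicalSpace L]

theorem Unavoidable.mono_level (hR : IsLAmb R) {A : Exp X} {C : Exp Y} {β γ : L} (hβγ : β ≤ γ)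
    (h : Unavoidable (cut R β) A C) : Unavoidable (cut R γ) A C :=
  h.mono fun _ hB => hR.mono _ _ _ _ _ _ Subset.rfl Subset.rfl hβγ hB

theorem isLAmb_lpinv [T2Space X] [CompactLawsonLattice L] (hR : IsLAmb R) : IsLAmb (lpinv R) where
  mono C C' F F' α α' hC hF hα h := by
    rcases h with h | h
    · exact Or.inl (le_bot_iff.1 (hα.trans h.le))
    · exact Or.inr fun β hβ => pinv_mono hC hF (h β (hβ.trans_le hα))
  sup C F α β hα hβ := by
    by_cases hα0 : α = ⊥
    · rwa [hα0, bot_sup_eq]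
    by_cases hβ0 : β = ⊥
    · rwa [hβ0, sup_bot_eq]
    refine Or.inr fun γ hγ A hA => ?_
    obtain ⟨α', β', hα', hβ', hle⟩ := WayBelow.exists_le_sup (L := L) hγ
    obtain ⟨B₁, hB₁, hd₁⟩ := (hα.resolve_left hα0) α' hα' A hA
    obtain ⟨B₂, hB₂, hd₂⟩ := (hβ.resolve_left hβ0) β' hβ' A hA
    refine ⟨B₁ ⊔ B₂, ?_, ?_⟩
    · refine hR.mono A A _ _ _ _ Subset.rfl Subset.rfl hle (hR.sup _ _ _ _ ?_ ?_)
      · exact hR.mono _ _ _ _ _ _ Subset.rfl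
          (by rw [NonemptyCompacts.coe_sup]; exact subset_union_left) le_rfl hB₁
      · exact hR.mono _ _ _ _ _ _ Subset.rfl
          (by rw [NonemptyCompacts.coe_sup]; exact subset_union_right) le_rfl hB₂
    · rw [NonemptyCompacts.coe_sup, union_inter_distrib_right, hd₁, hd₂, union_empty]
  whole C F α hF := Or.inr fun β _ => mem_pinv_of_eq_univ hF
  bot C F := Or.inl rfl
  closed_right C := by
    rw [← isOpen_compl_iff, isOpen_iff_mem_nhds]
    rintro ⟨F, α⟩ h
    obtain ⟨hα, A, β, hA, hβ, hC⟩ := notMem_lpinv_iff.1 h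
    rw [nhds_prod_eq]
    have hF : {F : Exp X | ∃ A : Exp X, (A : Set X) ⊆ (F : Set X)ᶜ ∧
        Unavoidable (cut R β) A C} ∈ 𝓝 F :=
      (isOpen_exists_subset_compl _).mem_nhds ⟨A, hA, hC⟩
    filter_upwards [prod_mem_prod hF (inter_mem (WayBelow.eventually hβ) (isOpen_ne.mem_nhds hα))]
    rintro ⟨F', α'⟩ ⟨⟨A', hA', hC'⟩, hβ', hα'⟩
    exact notMem_lpinv_iff.2 ⟨hα', A', β, hA', hβ', hC'⟩

theorem isLStrict_lpinv_of_lUnavoidableOpen [T2Space X] [CompactLawsonLattice L]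
    (h : LUnavoidableOpen R) : IsLStrict (lpinv R) := by
  intro F
  rw [← isOpen_compl_iff, isOpen_iff_mem_nhds]
  rintro ⟨C, α⟩ hCα
  obtain ⟨hα, A, β, hA, hβ, hC⟩ := notMem_lpinv_iff.1 hCα
  -- The level varies along with `C`: openness is applied at the fixed level `γ`, which stays way
  -- below every `α'` near `α`.
  obtain ⟨γ, hγ, hβγ, hγα⟩ := WayBelow.exists_between hβ hα
  rw [nhds_prod_eq]
  filter_upwards [prod_mem_prod
    ((h _ γ F.isCompact.isClosed.isOpen_compl hγ).mem_nhds ⟨A, β, hA, hβγ, hC⟩)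
    (inter_mem hγα.eventually (isOpen_ne.mem_nhds hα))]
  rintro ⟨C', α'⟩ ⟨⟨A', β', hA', hβ', hC'⟩, hγ', hα'⟩
  exact notMem_lpinv_iff.2 ⟨hα', A', β', hA', hβ'.trans_le hγ'.le, hC'⟩

theorem lUnavoidableOpen_of_isLStrict_lpinv [CompactSpace X] [CompactLawsonLattice L]
    (hpi : IsLPseudoInvertible R) (hs : IsLStrict (lpinv R)) : LUnavoidableOpen R := by
  intro U α hU hα
  by_cases hne : U = univ
  · subst hne
    rcases isEmpty_or_nonempty X with hX | hX
    · convert isOpen_empty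
      ext C
      simp only [mem_ofPred_eq, mem_empty_iff_false, iff_false]
      rintro ⟨A, -⟩
      exact hX.false A.nonempty.some
    · convert isOpen_univ
      ext C
      simp only [mem_ofPred_eq, mem_univ, iff_true]
      -- A nonzero level is needed, since the cut of `lpinv` at `⊥` is everything and carries no
      -- information.
      obtain ⟨γ, hγ, -, hγα⟩ := (wayBelow_bot α).exists_between hα
      refine ⟨⊤, γ, subset_univ _, hγα, fun B hB => ?_⟩
      have hB' : ((⊤ : Exp X), B, γ) ∈ lpinv (lpinv R) := by
        rw [hpi]
        exact hB
      rw [eq_univ_of_mem_pinv NonemptyCompacts.coe_top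
        ((hB'.resolve_left hγ) ⊥ (wayBelow_bot γ)), inter_univ]
      exact C.nonempty
  · obtain ⟨F, hF⟩ := exists_coe_eq_compl hU hne
    have h := ((hs F).preimage (Continuous.prodMk_left α)).isOpen_compl
    convert h using 1
    ext C
    exact ((notMem_lpinv_iff (R := R) (C := C) (F := F) (α := α)).trans
      (by simp only [hF, compl_compl, ne_eq, hα, not_false_eq_true, true_and, mem_ofPred_eq])).symm

theorem lLocalFinite_of_lUnavoidableOpen [CompactSpace X] [T2Space X] [CompactLawsonLattice L]
    (hR : IsLAmb R) (h : LUnavoidableOpen R) : LLocalFinite R := by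
  intro A U B α β hU hAU hα hB hβ
  -- The witnesses for nearby `C` have varying levels way below `γ`; `γ` bounds them all, so one cut
  -- suffices.
  obtain ⟨γ, hγ, hβγ, hγα⟩ := WayBelow.exists_between hβ hα
  obtain ⟨W, G, hW, hAW, hWG, hAG, hGU⟩ := exists_closed_nhd_subset A hU hAU
  obtain ⟨n, V, hV, hVB, hVS⟩ := exists_open_family_of_isOpen (h W γ hW hγ) ⟨A, β, hAW, hβγ, hB⟩
  refine ⟨n, V, γ, G, hV, hAG, hGU, hγα, hVB, fun B' hB' => hVS B' ?_⟩
  rintro C ⟨A', β', hA', hβ', hC⟩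
  exact hC.mono_level hR hβ'.le B' (hR.mono _ _ _ _ _ _ (hA'.trans hWG) Subset.rfl le_rfl hB')

end Fuzzy

end Ambiguous

theorem mainTheorem9 {X : Type*} {Y : Type*} {L : Type*}
    [TopologicalSpace X] [CompactSpace X] [T2Space X]
    [TopologicalSpace Y] [CompactSpace Y] [T2Space Y]
    [TopologicalSpace L] [DistribLattice L] [BoundedOrder L]
    [Ambiguous.CompactLawsonLattice L] :
    (∀ R : Set (Ambiguous.Exp X × Ambiguous.Exp Y × L),
      Ambiguous.IsLAmb R → Ambiguous.IsLStrict R → Ambiguous.IsLPseudoInvertible R →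
        (Ambiguous.IsOpenLAmb R ↔ Ambiguous.LUnavoidableOpen R) ∧
        (Ambiguous.IsOpenLAmb R ↔ Ambiguous.LLocalFinite R)) ∧
    (∀ R : Set (Ambiguous.Exp X × Ambiguous.Exp Y),
      Ambiguous.IsAmb R → Ambiguous.IsStrict R → Ambiguous.IsPseudoInvertible R →
        (Ambiguous.IsOpenAmb R ↔ Ambiguous.UnavoidableOpen R) ∧
        (Ambiguous.IsOpenAmb R ↔ Ambiguous.LocalFinite R)) := by
  refine ⟨fun R hR hs hpi => ?_, fun R hR hs hpi => ?_⟩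
  · have h₁₂ : Ambiguous.IsOpenLAmb R ↔ Ambiguous.LUnavoidableOpen R :=
      ⟨fun h => Ambiguous.lUnavoidableOpen_of_isLStrict_lpinv hpi h.pinv_strict,
        fun h => ⟨hR, hs, Ambiguous.isLAmb_lpinv hR,
          Ambiguous.isLStrict_lpinv_of_lUnavoidableOpen h, hpi⟩⟩
    exact ⟨h₁₂, h₁₂.trans ⟨Ambiguous.lLocalFinite_of_lUnavoidableOpen hR,
      Ambiguous.lUnavoidableOpen_of_lLocalFinite⟩⟩
  · have h₁₂ : Ambiguous.IsOpenAmb R ↔ Ambiguous.UnavoidableOpen R :=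
      ⟨fun h => Ambiguous.unavoidableOpen_of_isStrict_pinv hpi h.pinv_strict,
        fun h => ⟨hR, hs, hpi, Ambiguous.isAmb_pinv R,
          Ambiguous.isStrict_pinv_of_unavoidableOpen h⟩⟩
    exact ⟨h₁₂, h₁₂.trans ⟨Ambiguous.localFinite_of_unavoidableOpen hR,
      Ambiguous.unavoidableOpen_of_localFinite⟩⟩
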